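/- Let $\mathcal X$ be a feature space, $\mathcal Y=\{-1,+1\}$, and let $G$ be a (directed) manipulation graph on $\mathcal X$ with closed neighbourhoods $N_G[x]=\{x\}\cup\{x' : (x,x')\in E(G)\}$. An agent $(x,y)\in\mathcal X\times\mathcal Y$ facing a classifier $h:\mathcal X\to\mathcal Y$ moves to $z$, where $z=x$ if $h(x)=+1$ or if no $x'\in N_G[x]$ has $h(x')=+1$, and otherwise $z\in N_G[x]$ with $h(z)=+1$ is chosen by a fixed tie-breaking rule; the strategic loss is $\ell(h,(x,y))=\mathbf 1\{h(z)\neq y\}$. In each round $t=1,\dots,T$ the learner picks a distribution over classifiers as a function of its past observations $(h_s,z_s,y_s)_{s<t}$, an adaptive adversary picks an agent $(x_t,y_t)$ as a function of all past rounds $(h_s,x_s,y_s)_{s<t}$, the learner samples $h_t$ from its distribution, and it then observes the manipulated feature $z_t$ and the label $y_t$. The expected Stackelberg regret with respect to $\mathcal H$ is $\max_{h\in\mathcal H}\sum_{t=1}^T\mathbb E[\ell(h_t,(x_t,y_t))-\ell(h,(x_t,y_t))]$, the expectation being over the learner's sampling. **Theorem.** There is an absolute constant $C>0$ such that for every $\mathcal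 X$, every manipulation graph $G$ on $\mathcal X$, every finite nonempty class $\mathcal H=\{h^1,\dots,h^n\}\subseteq\mathcal Y^{\mathcal X}$ of size $n$, and every horizon $T\ge 1$, there is a proper learner (it only plays classifiers in $\mathcal H$) whose expected Stackelberg regret is at most $$C\left(\sqrt{T\log n}+n\log(nT)\right)$$ for every tie-breaking rule and against every adaptive adversary. Moreover, the learner can be taken to be the following algorithm. With $\varepsilon=1/(nT)$, $\eta=\sqrt{\log n/T}$, $\nu=1/16$ and $\Delta_{n,\varepsilon}=\{p\in\mathbb R^n:\sum_i p(i)=1,\ p(i)\ge\varepsilon \text{ for all } i\}$, in round $t$ it plays $h^i$ with probability $p_t(i)$, where $$p_t\in\arg\min_{p\in\Delta_{n,\varepsilon}}\Big\{\sum_{s<t}\langle\widehat d_s,p\rangle+\frac1\eta\sum_{i=1}^n p(i)\log p(i)-\frac1\nu\sum_{i=1}^n\log p(i)\Big\},$$ $$\widehat d_s(i)=\mathbf 1\{h_s\in R_s\}\,\mathbf 1\{h^i\in R_s\}\,\frac{y_s}{\sum_{j:h^j\in R_s}p_s(j)},\qquad R_s=\{h\in\mathcal H : h(x')=-1\ \text{for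 all } x'\in N_G[x_s]\}.$$ The estimate $\widehat d_s$ is a function of what the learner observes, because $h_s\in R_s$ if and only if $h_s(z_s)=-1$, and then $z_s=x_s$. (For $n=1$, where $\eta=0$, the set $\Delta_{1,\varepsilon}$ is a single point and the entropy term is read as $0$.) -/

import Mathlib

universe u

noncomputable section

namespace StrategicClassification

variable {X : Type u}

/-- Labels are `{-1, +1}`, realised as the units of `ℤ`. -/
abbrev Label : Type := ℤˣ

/-- A classifier on the feature space `X`. -/
abbrev Classifier (X : Type u) : Type u := X → Label

/-- An agent: its original feature vector and its true label. -/
abbrev Agent (X : Type u) : Type u := X × Label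

/-- The closed neighbourhood `N_G[x]` in the manipulation graph; an edge `G.Adj x x'` says that an
agent with feature vector `x` can manipulate to `x'`. -/
def closedNbhd (G : Digraph X) (x : X) : Set X := {x' | x' = x ∨ G.Adj x x'}

/-- The set of best responses of `x` under the classifier `h`. -/
def bestResponses (G : Digraph X) (h : Classifier X) (x : X) : Set X :=
  {x' | x' ∈ closedNbhd G x ∧ h x' = 1}

/-- A fixed tie-breaking rule: it picks a best response whenever there is one. -/
structure TieBreaking (G : Digraph X) where
  /-- the selected feature vector -/
  pick : Classifier X → X → X
  pick_mem : ∀ h x, (bestResponses G h x).Nonempty → pick h x ∈ bestResponses G h x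

open Classical in
/-- The manipulated feature vector `z` of an agent at `x` responding to `h`. -/
def manipulate {G : Digraph X} (tie : TieBreaking G) (h : Classifier X) (x : X) : X :=
  if bestResponses G h x = ∅ ∨ x ∈ bestResponses G h x then x else tie.pick h x

/-- The strategic loss: the misclassification error after manipulation. -/
def strategicLoss {G : Digraph X} (tie : TieBreaking G) (h : Classifier X) (a : Agent X) : ℝ :=
  if h (manipulate tie h a.1) ≠ a.2 then 1 else 0

/-! ### The interaction protocol -/

/-- What the learner knows about a finished round: the classifier it played, the manipulated
feature vector and the true label (but not the original feature vector). -/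
structure Observation (X : Type u) where
  /-- the classifier that was sampled -/
  hyp : Classifier X
  /-- the manipulated feature vector -/
  feature : X
  /-- the true label -/
  label : Label

/-- A finished round: the sampled classifier and the agent chosen by the adversary. -/
structure Round (X : Type u) where
  /-- the classifier that was sampled -/
  hyp : Classifier X
  /-- the agent chosen by the adversary -/
  agent : Agent X

/-- What the learner observes of a round. -/
def Round.observe {G : Digraph X} (tie : TieBreaking G) (r : Round X) : Observation X where
  hyp := r.hyp
  feature := manipulate tie r.hyp r.agent.1
  label := r.agent.2

/-- A learner maps the list of past observations (most recent first) to the distribution from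
which the next classifier is sampled. -/
abbrev Learner (X : Type u) : Type u := List (Observation X) → PMF (Classifier X)

/-- An adaptive adversary maps the full list of past rounds (most recent first) to the next
agent. -/
abbrev Adversary (X : Type u) : Type u := List (Round X) → Agent X

/-- A learner is proper for `H` if it only ever plays classifiers in `H`. -/
def Learner.IsProper (H : Finset (Classifier X)) (L : Learner X) : Prop :=
  ∀ hist, (L hist).support ⊆ (H : Set (Classifier X))

/-- The law of the transcript (most recent round first) of the first `t` rounds. In each round the
agent depends on the past only, and the classifier is sampled from the learner's distribution. -/
def transcriptLaw {G : Digraph X} (tie : TieBreaking G) (L : Learner X) (A : Adversary X) :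
    ℕ → PMF (List (Round X))
  | 0 => PMF.pure []
  | t + 1 => (transcriptLaw tie L A t).bind fun τ =>
      (L (τ.map (Round.observe tie))).map fun h => ⟨h, A τ⟩ :: τ

/-- Expectation of a real-valued function under a discrete law. -/
def expectation {α : Type*} (μ : PMF α) (f : α → ℝ) : ℝ := ∑' a, (μ a).toReal * f a

/-- The cumulative loss on a transcript in excess of that of the fixed classifier `h`. -/
def excessLoss {G : Digraph X} (tie : TieBreaking G) (h : Classifier X) (τ : List (Round X)) : ℝ :=
  (τ.map fun r => strategicLoss tie r.hyp r.agent - strategicLoss tie h r.agent).sum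

/-- The expected Stackelberg regret after `T` rounds: the maximum over `h ∈ H` of the expected
cumulative excess loss over `h`. -/
def expectedRegret {G : Digraph X} (tie : TieBreaking G) (H : Finset (Classifier X))
    (hH : H.Nonempty) (T : ℕ) (L : Learner X) (A : Adversary X) : ℝ :=
  H.sup' hH fun h => expectation (transcriptLaw tie L A T) (excessLoss tie h)

/-! ### The algorithm -/

/-- The classifiers labelling all of `N_G[x]` negatively. -/
def allNegative (G : Digraph X) (x : X) : Set (Classifier X) :=
  {h | ∀ x' ∈ closedNbhd G x, h x' = -1}

open Classical in
/-- The probability that weights `p` on `H` give to the members of `H` that label all of `N_G[x]`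
negatively. -/
def allNegativeMass (G : Digraph X) (H : Finset (Classifier X)) (p : H → ℝ) (x : X) : ℝ :=
  ∑ i : H, if i.1 ∈ allNegative G x then p i else 0

open Classical in
/-- The importance-weighted estimator of the shifted losses, computed from an observation. See
`estimator_observe` for its expression through the original feature vector. -/
def estimator (G : Digraph X) (H : Finset (Classifier X)) (p : H → ℝ) (o : Observation X)
    (i : H) : ℝ :=
  if o.hyp o.feature = -1 ∧ i.1 ∈ allNegative G o.feature then
    ((o.label : ℤ) : ℝ) / allNegativeMass G H p o.feature
  else 0

open Classical in
theorem estimator_observe {G : Digraph X} (tie : TieBreaking G) (H : Finset (Classifier X))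
    (p : H → ℝ) (r : Round X) (i : H) :
    estimator G H p (r.observe tie) i =
      (if r.hyp ∈ allNegative G r.agent.1 then 1 else 0) *
        (if i.1 ∈ allNegative G r.agent.1 then 1 else 0) *
        (((r.agent.2 : ℤ) : ℝ) / allNegativeMass G H p r.agent.1) := by
  have hne : (1 : Label) ≠ -1 := by decide
  obtain ⟨h, x, y⟩ := r
  simp only [estimator, Round.observe]
  by_cases hR : h ∈ allNegative G x
  · have hempty : bestResponses G h x = ∅ := by
      ext x'
      simp only [bestResponses, Set.mem_ofPred_eq, Set.mem_empty_iff_false, iff_false, not_and]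
      intro hx' h1
      exact hne (h1.symm.trans (hR x' hx'))
    have hz : manipulate tie h x = x := by simp [manipulate, hempty]
    have hx : h x = -1 := hR x (Or.inl rfl)
    simp [hz, hx, hR]
  · have hz : h (manipulate tie h x) = 1 := by
      have hne' : (bestResponses G h x).Nonempty := by
        simp only [allNegative, Set.mem_ofPred_eq, not_forall] at hR
        obtain ⟨x', hx', h1⟩ := hR
        exact ⟨x', hx', (Int.units_eq_one_or (h x')).resolve_right h1⟩
      unfold manipulate
      split_ifs with hc
      · rcases hc with hc | hc
        · exact absurd hc hne'.ne_empty
        · exact hc.2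
      · exact (tie.pick_mem h x hne').2
    simp [hz, hne, hR]

/-- The probabilities with which the learner plays the members of `H` after a given history. -/
def Learner.weights (L : Learner X) (H : Finset (Classifier X)) (hist : List (Observation X)) :
    H → ℝ :=
  fun i => (L hist i.1).toReal

/-- The sum of the loss estimates over a history (most recent observation first); the estimate of
a round uses the probabilities the learner used in that round. -/
def cumulativeEstimate (G : Digraph X) (H : Finset (Classifier X)) (L : Learner X) :
    List (Observation X) → H → ℝ
  | [] => 0
  | o :: hist => cumulativeEstimate G H L hist + estimator G H (L.weights H hist) o

/-- The `ε`-shrunk probability simplex. -/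
def shrunkSimplex (ι : Type*) [Fintype ι] (ε : ℝ) : Set (ι → ℝ) :=
  {p | p ∈ stdSimplex ℝ ι ∧ ∀ i, ε ≤ p i}

/-- The entropy plus log-barrier regularizer. -/
def regularizer {ι : Type*} [Fintype ι] (η ν : ℝ) (p : ι → ℝ) : ℝ :=
  1 / η * ∑ i, p i * Real.log (p i) - 1 / ν * ∑ i, Real.log (p i)

/-- `L` is follow-the-regularized-leader on `H` with parameters `ε`, `η`, `ν`: after every history
its probabilities minimize the cumulative loss estimate plus the regularizer over the
`ε`-shrunk simplex. -/
def Learner.IsFTRL (G : Digraph X) (H : Finset (Classifier X)) (ε η ν : ℝ) (L : Learner X) :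
    Prop :=
  ∀ hist, L.weights H hist ∈ shrunkSimplex H ε ∧
    IsMinOn (fun p : H → ℝ => (∑ i, cumulativeEstimate G H L hist i * p i) + regularizer η ν p)
      (shrunkSimplex H ε) (L.weights H hist)

end StrategicClassification

end

noncomputable section

namespace StrategicClassification

open Finset InformationTheory

/-! ### Expectations under laws of finite support -/

section Expectation

variable {α β : Type*}

/-! After manipulation, a classifier predicts `-1` exactly when it is negative on the whole closed
neighbourhood, i.e. lies in `R`. So its loss is `1{y = -1} + 1{h ∈ R} y` (`strategicLoss_eq`), and
regret only involves the shifted loss `1{h ∈ R} y`. The importance-weighted estimate has this as its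
conditional mean, since `R` is hit with probability equal to its mass `P`.

The point is to avoid a factor `n` in the variance. An estimate is a constant `y / P` on `R` and
zero elsewhere, so by Jensen its stability reduces to one scalar, the ratio `r` of new to old mass
of `R` (`stability_le_regularizerDivergence`). Entropy pays for `r ≤ 4`, the log barrier for `r ≥
4`. The cost `O(η / P)` is incurred only when `R` is hit, hence `O(η)` per round on average.

These bounds combine in a potential: excess loss, minus the optimal FTRL value, plus the estimated
loss of a comparator `u` near a vertex. Its conditional drift is `O(η + nε)` per round against any
adaptive adversary. It starts at most at `log n / η`, and it dominates the excess loss up to the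
regularizer of `u`, which is at most `16 n log (1/ε)`. -/

theorem expectation_eq_sum (μ : PMF α) (f : α → ℝ) (S : Finset α) (hS : μ.support ⊆ S) :
    expectation μ f = ∑ a ∈ S, (μ a).toReal * f a := by
  refine tsum_eq_sum fun a ha => ?_
  have : μ a = 0 := by
    by_contra h
    exact ha (hS ((PMF.mem_support_iff _ _).2 h))
  simp [this]

theorem sum_toReal_eq_one (μ : PMF α) (S : Finset α) (hS : μ.support ⊆ S) :
    ∑ a ∈ S, (μ a).toReal = 1 := by
  rw [← ENNReal.toReal_sum fun a _ => μ.apply_ne_top a, ← tsum_eq_sum (L := .unconditional _),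
    μ.tsum_coe, ENNReal.toReal_one]
  intro a ha
  by_contra h
  exact ha (hS ((PMF.mem_support_iff _ _).2 h))

theorem expectation_pure (a : α) (f : α → ℝ) : expectation (PMF.pure a) f = f a := by
  classical
  rw [expectation_eq_sum _ f {a} (by simp [PMF.support_pure])]
  simp

theorem expectation_bind (μ : PMF α) (κ : α → PMF β) (f : β → ℝ) (hμ : μ.support.Finite)
    (hκ : ∀ a, (κ a).support.Finite) :
    expectation (μ.bind κ) f = expectation μ fun a => expectation (κ a) f := by
  classical
  set S : Finset α := hμ.toFinset
  have hS : μ.support ⊆ S := by simp [S]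
  set U : Finset β := S.biUnion fun a => (hκ a).toFinset
  have hU : ∀ a ∈ S, (κ a).support ⊆ U := fun a ha b hb => by
    simp only [U, coe_biUnion, Set.mem_iUnion]
    exact ⟨a, ha, by simpa using hb⟩
  have hbU : (μ.bind κ).support ⊆ U := by
    intro b hb
    rw [PMF.mem_support_bind_iff] at hb
    obtain ⟨a, ha, hb⟩ := hb
    exact hU a (hS ha) hb
  rw [expectation_eq_sum _ f U hbU, expectation_eq_sum _ _ S hS]
  have h1 : ∀ b, ((μ.bind κ) b).toReal = ∑ a ∈ S, (μ a).toReal * (κ a b).toReal := by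
    intro b
    rw [PMF.bind_apply, tsum_eq_sum (s := S), ENNReal.toReal_sum]
    · simp
    · exact fun a _ => ENNReal.mul_ne_top (μ.apply_ne_top a) ((κ a).apply_ne_top b)
    · intro a ha
      have : μ a = 0 := by
        by_contra h
        exact ha (hS ((PMF.mem_support_iff _ _).2 h))
      simp [this]
  simp_rw [h1, sum_mul]
  rw [sum_comm]
  refine sum_congr rfl fun a ha => ?_
  rw [expectation_eq_sum _ f U (hU a ha), mul_sum]
  exact sum_congr rfl fun b _ => by ring

theorem expectation_le_add_const (μ : PMF α) (hμ : μ.support.Finite) {f g : α → ℝ} {c : ℝ}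
    (h : ∀ a, f a ≤ g a + c) : expectation μ f ≤ expectation μ g + c := by
  have hS : μ.support ⊆ hμ.toFinset := by simp
  rw [expectation_eq_sum _ f _ hS, expectation_eq_sum _ g _ hS]
  calc _ ≤ ∑ a ∈ hμ.toFinset, ((μ a).toReal * g a + (μ a).toReal * c) :=
        sum_le_sum fun a _ => by
          rw [← mul_add]
          exact mul_le_mul_of_nonneg_left (h a) ENNReal.toReal_nonneg
    _ = _ := by rw [sum_add_distrib, ← sum_mul, sum_toReal_eq_one μ _ hS, one_mul]

end Expectation

/-! ### Drift bounds along the transcript -/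

section Transcript

variable {X : Type u} {G : Digraph X} (tie : TieBreaking G) {H : Finset (Classifier X)}
  {L : Learner X} (A : Adversary X)

theorem transcriptLaw_support_finite (hL : L.IsProper H) (t : ℕ) :
    (transcriptLaw tie L A t).support.Finite := by
  induction t with
  | zero => simp [transcriptLaw, PMF.support_pure]
  | succ t ih =>
    rw [transcriptLaw, PMF.support_bind]
    refine ih.biUnion fun τ _ => ?_
    rw [PMF.support_map]
    exact (H.finite_toSet.subset (hL _)).image _

/-- The law of the next round averages over the members of `H` with the learner's weights. -/
theorem expectation_transcriptLaw_succ (hL : L.IsProper H) (t : ℕ) (Z : List (Round X) → ℝ) :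
    expectation (transcriptLaw tie L A (t + 1)) Z =
      expectation (transcriptLaw tie L A t) fun τ =>
        ∑ i : H, L.weights H (τ.map (Round.observe tie)) i * Z (⟨i.1, A τ⟩ :: τ) := by
  have hfin : ∀ hist, (L hist).support.Finite := fun hist => H.finite_toSet.subset (hL hist)
  rw [transcriptLaw, expectation_bind _ _ _ (transcriptLaw_support_finite tie A hL t)]
  · congr 1
    funext τ
    rw [PMF.map, expectation_bind _ _ _ (hfin _)]
    · simp only [Function.comp_apply, expectation_pure]
      rw [expectation_eq_sum _ _ H (hL _), ← sum_coe_sort]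
      rfl
    · intro h
      simp [PMF.support_pure]
  · intro τ
    rw [PMF.support_map]
    exact (hfin _).image _

/-- A supermartingale argument. Since `A τ` is determined by `τ`, a drift bound at every transcript
covers adaptive adversaries. -/
theorem expectation_transcriptLaw_le (hL : L.IsProper H) (Z : List (Round X) → ℝ) (c : ℝ)
    (hZ : ∀ τ, ∑ i : H, L.weights H (τ.map (Round.observe tie)) i * Z (⟨i.1, A τ⟩ :: τ) ≤ Z τ + c)
    (t : ℕ) : expectation (transcriptLaw tie L A t) Z ≤ Z [] + t * c := by
  induction t with
  | zero => simp [transcriptLaw, expectation_pure]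
  | succ t ih =>
    rw [expectation_transcriptLaw_succ tie A hL]
    have := expectation_le_add_const _ (transcriptLaw_support_finite tie A hL t) hZ
    push_cast
    linarith

end Transcript

/-! ### The strategic loss -/

section Loss

variable {X : Type u} {G : Digraph X} (tie : TieBreaking G)

open Classical in
theorem apply_manipulate (h : Classifier X) (x : X) :
    h (manipulate tie h x) = if h ∈ allNegative G x then -1 else 1 := by
  have hne : (1 : Label) ≠ -1 := by decide
  split_ifs with hR
  · refine hR _ ?_
    unfold manipulate
    split_ifs with hc
    · exact Or.inl rfl
    · push Not at hc
      exact (tie.pick_mem h x hc.1).1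
  · have hne' : (bestResponses G h x).Nonempty := by
      simp only [allNegative, Set.mem_ofPred_eq, not_forall] at hR
      obtain ⟨x', hx', h1⟩ := hR
      exact ⟨x', hx', (Int.units_eq_one_or (h x')).resolve_right h1⟩
    unfold manipulate
    split_ifs with hc
    · rcases hc with hc | hc
      · exact absurd hc hne'.ne_empty
      · exact hc.2
    · exact (tie.pick_mem h x hne').2

open Classical in
/-- Up to a shift not depending on the classifier, the loss is the label on `allNegative`. -/
theorem strategicLoss_eq (h : Classifier X) (a : Agent X) :
    strategicLoss tie h a = (if a.2 = -1 then 1 else 0) +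
      (if h ∈ allNegative G a.1 then 1 else 0) * ((a.2 : ℤ) : ℝ) := by
  have hne : (1 : Label) ≠ -1 := by decide
  have hne' : (-1 : Label) ≠ 1 := by decide
  rw [strategicLoss, apply_manipulate tie h]
  obtain ⟨x, y⟩ := a
  rcases Int.units_eq_one_or y with rfl | rfl <;> by_cases hR : h ∈ allNegative G x <;>
    simp [hR, hne, hne']

theorem excessLoss_cons (h : Classifier X) (r : Round X) (τ : List (Round X)) :
    excessLoss tie h (r :: τ) =
      strategicLoss tie r.hyp r.agent - strategicLoss tie h r.agent + excessLoss tie h τ := by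
  simp [excessLoss]

end Loss

/-! ### Follow-the-regularized-leader -/

section FTRL

variable {ι : Type*} [Fintype ι]

theorem shrunkSimplex_isCompact (ε : ℝ) : IsCompact (shrunkSimplex ι ε) := by
  refine (isCompact_stdSimplex ℝ ι).inter_right (t := {p | ∀ i, ε ≤ p i}) ?_
  simp only [Set.ofPred_forall]
  exact isClosed_iInter fun i => isClosed_le continuous_const (continuous_apply i)

theorem exists_isMinOn_regularized {ε : ℝ} (hε : 0 < ε) (hne : (shrunkSimplex ι ε).Nonempty)
    (η ν : ℝ) (c : ι → ℝ) :
    ∃ p ∈ shrunkSimplex ι ε,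
      IsMinOn (fun p => (∑ i, c i * p i) + regularizer η ν p) (shrunkSimplex ι ε) p := by
  refine (shrunkSimplex_isCompact ε).exists_isMinOn hne ?_
  unfold regularizer
  have hlog : ∀ i, ContinuousOn (fun p : ι → ℝ => Real.log (p i)) (shrunkSimplex ι ε) :=
    fun i => (continuous_apply i).continuousOn.log fun p hp => (hε.trans_le (hp.2 i)).ne'
  have happ : ∀ i, ContinuousOn (fun p : ι → ℝ => p i) (shrunkSimplex ι ε) :=
    fun i => (continuous_apply i).continuousOn
  refine ContinuousOn.add ?_ (ContinuousOn.sub ?_ ?_)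
  · exact continuousOn_finsetSum _ fun i _ => continuousOn_const.mul (happ i)
  · exact continuousOn_const.mul (continuousOn_finsetSum _ fun i _ => (happ i).mul (hlog i))
  · exact continuousOn_const.mul (continuousOn_finsetSum _ fun i _ => hlog i)

/-- A vertex has infinite log barrier, so the comparator is a vertex pulled slightly towards the
uniform distribution. -/
theorem mixed_vertex_mem_shrunkSimplex [DecidableEq ι] {ε : ℝ} (hε : 0 ≤ ε)
    (hε' : Fintype.card ι * ε ≤ 1) (k : ι) :
    (fun i => (1 - Fintype.card ι * ε) * (if i = k then 1 else 0) + ε) ∈ shrunkSimplex ι ε := by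
  have h : ∀ i, ε ≤ (1 - Fintype.card ι * ε) * (if i = k then 1 else 0) + ε := fun i => by
    split_ifs <;> linarith
  refine ⟨⟨fun i => hε.trans (h i), ?_⟩, h⟩
  simp [sum_add_distrib]

/-- The Bregman divergence of the regularizer between points of equal total mass. -/
def regularizerDivergence (η ν : ℝ) (q p : ι → ℝ) : ℝ :=
  1 / η * ∑ i, p i * klFun (q i / p i) + 1 / ν * ∑ i, (q i / p i - 1 - Real.log (q i / p i))

/-- The divergence is the gap between the objective and its linearization at `p`; by first-order
optimality the linear term towards `q` is nonnegative. -/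
theorem le_of_isMinOn_regularized {ε : ℝ} (hε : 0 < ε) (η ν : ℝ) {c p q : ι → ℝ}
    (hp : p ∈ shrunkSimplex ι ε) (hq : q ∈ shrunkSimplex ι ε)
    (hmin : IsMinOn (fun p => (∑ i, c i * p i) + regularizer η ν p) (shrunkSimplex ι ε) p) :
    (∑ i, c i * p i) + regularizer η ν p + regularizerDivergence η ν q p ≤
      (∑ i, c i * q i) + regularizer η ν q := by
  have hp0 : ∀ i, 0 < p i := fun i => hε.trans_le (hp.2 i)
  have hq0 : ∀ i, 0 < q i := fun i => hε.trans_le (hq.2 i)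
  set F : (ι → ℝ) → ℝ := fun p => (∑ i, c i * p i) + regularizer η ν p with hF
  set γ : ℝ → ι → ℝ := fun s i => p i + s * (q i - p i) with hγ
  set D : ℝ := (∑ i, c i * (q i - p i)) +
    (1 / η * ∑ i, (q i - p i) * (Real.log (p i) + 1) - 1 / ν * ∑ i, (q i - p i) / p i) with hD
  have hγd : ∀ i, HasDerivAt (fun s => γ s i) (q i - p i) 0 := fun i => by
    simpa [hγ] using ((hasDerivAt_id (0 : ℝ)).mul_const (q i - p i)).const_add (p i)
  have hγ0 : ∀ i, γ 0 i = p i := fun i => by simp [hγ]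
  have hlogd : ∀ i, HasDerivAt (fun s => Real.log (γ s i)) ((q i - p i) / p i) 0 := fun i => by
    have := (hγd i).log (by rw [hγ0]; exact (hp0 i).ne')
    rwa [hγ0] at this
  have hder : HasDerivAt (fun s => F (γ s)) D 0 := by
    refine HasDerivAt.add ?_ (HasDerivAt.sub ?_ ?_)
    · exact HasDerivAt.fun_sum fun i _ => (hγd i).const_mul _
    · refine HasDerivAt.const_mul _ (HasDerivAt.fun_sum fun i _ => ?_)
      refine ((hγd i).mul (hlogd i)).congr_deriv ?_
      rw [hγ0]
      field_simp [(hp0 i).ne']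
    · exact HasDerivAt.const_mul _ (HasDerivAt.fun_sum fun i _ => hlogd i)
  have hmem : ∀ s ∈ Set.Icc (0 : ℝ) 1, γ s ∈ shrunkSimplex ι ε := by
    intro s hs
    have hle : ∀ i, ε ≤ γ s i := fun i => by
      simp only [hγ]
      nlinarith [hp.2 i, hq.2 i, hs.1, hs.2, mul_nonneg hs.1 (sub_nonneg.2 (hq.2 i)),
        mul_nonneg (sub_nonneg.2 hs.2) (sub_nonneg.2 (hp.2 i))]
    refine ⟨⟨fun i => hε.le.trans (hle i), ?_⟩, hle⟩
    simp only [hγ, sum_add_distrib, ← mul_sum, sum_sub_distrib, hp.1.2, hq.1.2]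
    ring
  -- `D` is the derivative at `0` along the segment from `p` to `q`; only its right-hand difference
  -- quotients stay in the feasible set.
  have hD0 : 0 ≤ D := by
    have hlim := (hasDerivAt_iff_tendsto_slope_zero.1 hder).mono_left
      (nhdsWithin_mono (0 : ℝ) (fun s (hs : s ∈ Set.Ioi (0 : ℝ)) => ne_of_gt hs))
    refine ge_of_tendsto hlim ?_
    filter_upwards [Ioo_mem_nhdsGT (zero_lt_one' ℝ)] with s hs
    have h1 : F p ≤ F (γ s) := hmin (hmem s ⟨hs.1.le, hs.2.le⟩)
    have h2 : γ 0 = p := funext hγ0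
    rw [zero_add, h2, smul_eq_mul]
    exact mul_nonneg (inv_nonneg.2 hs.1.le) (sub_nonneg.2 h1)
  have hdiv : regularizerDivergence η ν q p = F q - F p - D := by
    have hent : ∑ i, p i * klFun (q i / p i) = (∑ i, q i * Real.log (q i)) -
        (∑ i, p i * Real.log (p i)) - ∑ i, (q i - p i) * (Real.log (p i) + 1) := by
      rw [← sum_sub_distrib, ← sum_sub_distrib]
      refine sum_congr rfl fun i _ => ?_
      have := (hp0 i).ne'
      rw [klFun, Real.log_div (hq0 i).ne' this]
      field_simp
      ring
    have hbar : ∑ i, (q i / p i - 1 - Real.log (q i / p i)) = (∑ i, Real.log (p i)) -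
        (∑ i, Real.log (q i)) + ∑ i, (q i - p i) / p i := by
      rw [← sum_sub_distrib, ← sum_add_distrib]
      refine sum_congr rfl fun i _ => ?_
      have := (hp0 i).ne'
      rw [Real.log_div (hq0 i).ne' this, sub_div, div_self this]
      ring
    have hlin : ∑ i, c i * (q i - p i) = ∑ i, c i * q i - ∑ i, c i * p i := by
      simp only [mul_sub, sum_sub_distrib]
    rw [regularizerDivergence, hent, hbar]
    simp only [hF, hD, regularizer, hlin]
    ring
  change F p + _ ≤ F q
  linarith

/-! ### Scalar inequalities and stability -/

theorem sq_sqrt_sub_one_le_klFun {r : ℝ} (hr : 0 < r) : (Real.sqrt r - 1) ^ 2 ≤ klFun r := by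
  set w := Real.sqrt r
  have hw : 0 < w := Real.sqrt_pos.2 hr
  have hrw : r = w ^ 2 := (Real.sq_sqrt hr.le).symm
  have hlog : 1 - w⁻¹ ≤ Real.log w := Real.one_sub_inv_le_log_of_pos hw
  have h1 : w ^ 2 * (1 - w⁻¹) ≤ w ^ 2 * Real.log w := mul_le_mul_of_nonneg_left hlog (by positivity)
  have h2 : w ^ 2 * (1 - w⁻¹) = w ^ 2 - w := by field_simp
  rw [klFun, hrw, Real.log_pow]
  push_cast
  nlinarith

theorem sq_sub_one_le_klFun {r : ℝ} (hr : 0 < r) (hr' : r ≤ 4) :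
    (r - 1) ^ 2 / 9 ≤ klFun r := by
  refine le_trans ?_ (sq_sqrt_sub_one_le_klFun hr)
  set w := Real.sqrt r
  have hw : 0 ≤ w := Real.sqrt_nonneg r
  have hrw : r = w ^ 2 := (Real.sq_sqrt hr.le).symm
  have hw2 : w ≤ 2 := by nlinarith
  have h : (r - 1) ^ 2 = (w - 1) ^ 2 * (w + 1) ^ 2 := by rw [hrw]; ring
  have h9 : (w + 1) ^ 2 ≤ 9 := by nlinarith
  rw [h]
  nlinarith [mul_le_mul_of_nonneg_left h9 (sq_nonneg (w - 1))]

/-- For `r ≤ 4`, `klFun` is quadratic around `1` and AM-GM trades the linear term for `9 / (4a)`.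
For larger `r`, `a` may be too small for entropy to help, but the barrier grows linearly and absorbs
`r - 1`. -/
theorem scalar_stability {r a y : ℝ} (hr : 0 < r) (ha : 0 < a) (hy : |y| ≤ 1) :
    y * (1 - r) ≤ a * klFun r + 16 * (r - 1 - Real.log r) + 9 / (4 * a) := by
  have hbar : 0 ≤ r - 1 - Real.log r := by linarith [Real.log_le_sub_one_of_pos hr]
  have hle : y * (1 - r) ≤ |r - 1| := by
    refine (le_abs_self _).trans ?_
    rw [abs_mul, abs_sub_comm 1 r]
    exact mul_le_of_le_one_left (abs_nonneg _) hy
  refine hle.trans ?_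
  rcases le_total r 4 with h4 | h4
  · have h1 : a * ((r - 1) ^ 2 / 9) ≤ a * klFun r :=
      mul_le_mul_of_nonneg_left (sq_sub_one_le_klFun hr h4) ha.le
    have h2 : |r - 1| ≤ a * (|r - 1| ^ 2 / 9) + 9 / (4 * a) := by
      have : a * (|r - 1| ^ 2 / 9) + 9 / (4 * a) - |r - 1| =
          (2 * a * |r - 1| - 9) ^ 2 / (36 * a) := by
        field_simp
        ring
      have h3 : 0 ≤ (2 * a * |r - 1| - 9) ^ 2 / (36 * a) := by positivity
      linarith
    rw [sq_abs] at h2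
    linarith
  · have hlog : Real.log r ≤ r / 4 - 1 + 2 * Real.log 2 := by
      have h := Real.log_le_sub_one_of_pos (show 0 < r / 4 by linarith)
      rw [Real.log_div hr.ne' (by norm_num), show (4 : ℝ) = 2 ^ 2 by norm_num, Real.log_pow] at h
      push_cast at h
      linarith
    have hk := mul_nonneg ha.le (klFun_nonneg hr.le)
    have hpos : 0 ≤ 9 / (4 * a) := by positivity
    rw [abs_of_nonneg (by linarith)]
    linarith [Real.log_two_lt_d9]

theorem convexOn_sub_one_sub_log :
    ConvexOn ℝ (Set.Ioi 0) fun r : ℝ => r - 1 - Real.log r :=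
  ((convexOn_id (convex_Ioi 0)).sub (concaveOn_const 1 (convex_Ioi 0))).sub
    strictConcaveOn_log_Ioi.concaveOn

/-- Stability for a loss that is constant on `R` and vanishes outside. -/
theorem stability_le_regularizerDivergence {η : ℝ} (hη : 0 < η) {p q : ι → ℝ}
    (hp : ∀ i, 0 < p i) (hq : ∀ i, 0 < q i) (R : Finset ι) (hR : R.Nonempty) {y : ℝ}
    (hy : |y| ≤ 1) :
    y / (∑ i ∈ R, p i) * (∑ i ∈ R, p i - ∑ i ∈ R, q i) ≤
      regularizerDivergence η (1 / 16) q p + 9 * η / (4 * ∑ i ∈ R, p i) := by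
  set P := ∑ i ∈ R, p i with hPdef
  set Q := ∑ i ∈ R, q i with hQdef
  have hP : 0 < P := sum_pos (fun i _ => hp i) hR
  have hQ : 0 < Q := sum_pos (fun i _ => hq i) hR
  have hw0 : ∀ i ∈ R, 0 ≤ p i / P := fun i _ => (div_pos (hp i) hP).le
  have hw1 : ∑ i ∈ R, p i / P = 1 := by rw [← sum_div, div_self hP.ne']
  have hmean : ∑ i ∈ R, p i / P * (q i / p i) = Q / P := by
    rw [hQdef, sum_div]
    refine sum_congr rfl fun i _ => ?_
    have := (hp i).ne'
    field_simp
  have hkl : P * klFun (Q / P) ≤ ∑ i, p i * klFun (q i / p i) := by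
    have hJ := convexOn_klFun.map_sum_le hw0 hw1
      (fun i _ => (div_pos (hq i) (hp i)).le : ∀ i ∈ R, q i / p i ∈ Set.Ici 0)
    simp only [smul_eq_mul, hmean] at hJ
    calc P * klFun (Q / P) ≤ P * ∑ i ∈ R, p i / P * klFun (q i / p i) :=
          mul_le_mul_of_nonneg_left hJ hP.le
      _ = ∑ i ∈ R, p i * klFun (q i / p i) := by
          rw [mul_sum]
          refine sum_congr rfl fun i _ => ?_
          field_simp
      _ ≤ _ := sum_le_univ_sum_of_nonneg fun i =>
          mul_nonneg (hp i).le (klFun_nonneg (div_pos (hq i) (hp i)).le)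
  have hφ0 : ∀ i, 0 ≤ q i / p i - 1 - Real.log (q i / p i) := fun i => by
    linarith [Real.log_le_sub_one_of_pos (div_pos (hq i) (hp i))]
  have hbar : Q / P - 1 - Real.log (Q / P) ≤ ∑ i, (q i / p i - 1 - Real.log (q i / p i)) := by
    have hJ := convexOn_sub_one_sub_log.map_sum_le hw0 hw1
      (fun i _ => div_pos (hq i) (hp i) : ∀ i ∈ R, q i / p i ∈ Set.Ioi 0)
    simp only [smul_eq_mul, hmean] at hJ
    -- Unlike entropy, the barrier is unweighted; the Jensen weights `p i / P` are at most `1` and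
    -- can be dropped from nonnegative terms.
    refine hJ.trans (le_trans (sum_le_sum fun i hi => ?_) (sum_le_univ_sum_of_nonneg hφ0))
    refine mul_le_of_le_one_left (hφ0 i) ((div_le_one hP).2 ?_)
    exact single_le_sum (f := p) (fun j _ => (hp j).le) hi
  have hs := scalar_stability (div_pos hQ hP) (div_pos hP hη) hy
  have e1 : y / P * (P - Q) = y * (1 - Q / P) := by field_simp
  have e2 : 9 / (4 * (P / η)) = 9 * η / (4 * P) := by field_simp
  have e3 : P / η * klFun (Q / P) = 1 / η * (P * klFun (Q / P)) := by ring
  rw [e2, e3] at hs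
  have := mul_le_mul_of_nonneg_left hkl (one_div_pos.2 hη).le
  rw [e1, regularizerDivergence]
  norm_num only [one_div_one_div] at *
  linarith

/-! ### Range of the regularizer -/

theorem apply_le_one_of_mem_shrunkSimplex {ε : ℝ} {p : ι → ℝ} (hp : p ∈ shrunkSimplex ι ε)
    (i : ι) : p i ≤ 1 := by
  rw [← hp.1.2]
  exact single_le_sum (fun j _ => hp.1.1 j) (mem_univ i)

theorem regularizer_le {ε η ν : ℝ} (hε : 0 < ε) (hη : 0 ≤ η) (hν : 0 ≤ ν) {p : ι → ℝ}
    (hp : p ∈ shrunkSimplex ι ε) :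
    regularizer η ν p ≤ 1 / ν * (Fintype.card ι * Real.log (1 / ε)) := by
  have h1 : ∑ i, p i * Real.log (p i) ≤ 0 := sum_nonpos fun i _ =>
    mul_nonpos_of_nonneg_of_nonpos (hp.1.1 i)
      (Real.log_nonpos (hp.1.1 i) (apply_le_one_of_mem_shrunkSimplex hp i))
  have h2 : -∑ i, Real.log (p i) ≤ Fintype.card ι * Real.log (1 / ε) := by
    rw [← sum_neg_distrib]
    refine (sum_le_sum (g := fun _ => Real.log (1 / ε)) fun i _ => ?_).trans (by simp)
    rw [one_div, Real.log_inv]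
    exact neg_le_neg (Real.log_le_log hε (hp.2 i))
  have h3 := mul_le_mul_of_nonneg_left h2 (one_div_nonneg.2 hν)
  have h4 := mul_nonpos_of_nonneg_of_nonpos (one_div_nonneg.2 hη) h1
  rw [regularizer]
  linarith

theorem le_regularizer {ε η ν : ℝ} (hε : 0 < ε) (hη : 0 ≤ η) (hν : 0 ≤ ν) {p : ι → ℝ}
    (hp : p ∈ shrunkSimplex ι ε) :
    -(1 / η * Real.log (Fintype.card ι)) ≤ regularizer η ν p := by
  have hp0 : ∀ i, 0 < p i := fun i => hε.trans_le (hp.2 i)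
  have hn : (0 : ℝ) < Fintype.card ι := by
    rcases isEmpty_or_nonempty ι with h | h
    · simpa using hp.1.2
    · exact_mod_cast Fintype.card_pos
  set n : ℝ := (Fintype.card ι : ℝ) with hndef
  have h1 : -Real.log n ≤ ∑ i, p i * Real.log (p i) := by
    have h : ∀ i, p i - 1 / n ≤ p i * Real.log (p i) + p i * Real.log n := fun i => by
      have hl := Real.one_sub_inv_le_log_of_pos (mul_pos (hp0 i) hn)
      have := mul_le_mul_of_nonneg_left hl (hp0 i).le
      rw [Real.log_mul (hp0 i).ne' hn.ne'] at this
      have e : p i * (1 - (p i * n)⁻¹) = p i - 1 / n := by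
        have := (hp0 i).ne'
        field_simp
      linarith
    have hs := sum_le_sum fun i (_ : i ∈ (univ : Finset ι)) => h i
    rw [sum_sub_distrib, sum_add_distrib, ← sum_mul, hp.1.2] at hs
    simp only [sum_const, card_univ, nsmul_eq_mul, ← hndef] at hs
    rw [mul_one_div_cancel hn.ne'] at hs
    linarith
  have h2 : ∑ i, Real.log (p i) ≤ 0 := sum_nonpos fun i _ =>
    Real.log_nonpos (hp.1.1 i) (apply_le_one_of_mem_shrunkSimplex hp i)
  have h3 := mul_le_mul_of_nonneg_left h1 (one_div_nonneg.2 hη)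
  have h4 := mul_nonpos_of_nonneg_of_nonpos (one_div_nonneg.2 hν) h2
  rw [regularizer]
  linarith

end FTRL

/-! ### The learner -/

section Learner

variable {X : Type u}

/-- The learner that plays `i ∈ H` with probability `w hist i`. -/
theorem exists_learner_of_weights (H : Finset (Classifier X))
    (w : List (Observation X) → H → ℝ) (hw : ∀ hist, w hist ∈ stdSimplex ℝ H) :
    ∃ L : Learner X, L.IsProper H ∧ ∀ hist, L.weights H hist = w hist := by
  classical
  refine ⟨fun hist => PMF.ofFinset
    (fun h => if hh : h ∈ H then ENNReal.ofReal (w hist ⟨h, hh⟩) else 0) H ?_ ?_, ?_, ?_⟩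
  · rw [← sum_coe_sort]
    simp only [coe_mem, dite_true, Subtype.coe_eta]
    rw [← ENNReal.ofReal_sum_of_nonneg fun i _ => (hw hist).1 i, (hw hist).2, ENNReal.ofReal_one]
  · intro h hh
    simp [hh]
  · intro hist h hh
    by_contra hn
    rw [PMF.mem_support_iff, PMF.ofFinset_apply] at hh
    exact hh (dif_neg hn)
  · intro hist
    funext i
    simp [Learner.weights, (hw hist).1 i]

/-- The estimates depend on the learner's own weights. The circularity is broken by choosing the
minimizer as a function of the cumulative vector alone and building that vector by recursion on the
history. -/
theorem exists_isFTRL (G : Digraph X) (H : Finset (Classifier X)) {ε : ℝ} (hε : 0 < ε)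
    (hne : (shrunkSimplex H ε).Nonempty) (η ν : ℝ) :
    ∃ L : Learner X, L.IsProper H ∧ L.IsFTRL G H ε η ν := by
  choose p hp hmin using exists_isMinOn_regularized hε hne η ν
  let cum : List (Observation X) → H → ℝ := fun hist =>
    hist.foldr (fun o c => c + estimator G H (p c) o) 0
  obtain ⟨L, hL, hw⟩ := exists_learner_of_weights H (fun hist => p (cum hist))
    fun hist => (hp _).1
  have hcum : ∀ hist, cumulativeEstimate G H L hist = cum hist := by
    intro hist
    induction hist with
    | nil => rfl
    | cons o hist ih => rw [cumulativeEstimate, ih, hw]; rfl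
  refine ⟨L, hL, fun hist => ?_⟩
  rw [hw, hcum]
  exact ⟨hp _, hmin _⟩

end Learner

/-! ### The regret bound -/

section Regret

variable {X : Type u} {G : Digraph X} (tie : TieBreaking G) {H : Finset (Classifier X)}
  {L : Learner X} (A : Adversary X)

open Classical in
theorem sum_estimator_observe_mul (p v : H → ℝ) (r : Round X) :
    ∑ i, estimator G H p (r.observe tie) i * v i =
      (if r.hyp ∈ allNegative G r.agent.1 then 1 else 0) *
        (((r.agent.2 : ℤ) : ℝ) / allNegativeMass G H p r.agent.1 *
          allNegativeMass G H v r.agent.1) := by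
  conv_rhs => rw [allNegativeMass.eq_def G H v]
  rw [mul_sum, mul_sum]
  refine sum_congr rfl fun i _ => ?_
  rw [estimator_observe]
  by_cases hi : i.1 ∈ allNegative G r.agent.1 <;> simp [hi]

/-- The least value of the regularized cumulative estimate. -/
def leaderValue (G : Digraph X) (H : Finset (Classifier X)) (η ν : ℝ) (L : Learner X)
    (hist : List (Observation X)) : ℝ :=
  (∑ i, cumulativeEstimate G H L hist i * L.weights H hist i) +
    regularizer η ν (L.weights H hist)

open Classical in
-- When `R` is hit, the optimal value grows by at least the estimated loss `y` of the current
-- weights, minus the stability cost. Otherwise the estimate vanishes and the value cannot decrease.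
theorem leaderValue_observe_cons {ε η : ℝ} (hε : 0 < ε) (hη : 0 < η)
    (hL : L.IsFTRL G H ε η (1 / 16)) (hist : List (Observation X)) (r : Round X)
    (hr : r.hyp ∈ H) :
    leaderValue G H η (1 / 16) L hist + (if r.hyp ∈ allNegative G r.agent.1 then 1 else 0) *
        (((r.agent.2 : ℤ) : ℝ) -
          9 * η / 4 / allNegativeMass G H (L.weights H hist) r.agent.1) ≤
      leaderValue G H η (1 / 16) L (r.observe tie :: hist) := by
  set p := L.weights H hist with hpdef
  set q := L.weights H (r.observe tie :: hist) with hqdef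
  have hp : p ∈ shrunkSimplex H ε := (hL hist).1
  have hq : q ∈ shrunkSimplex H ε := (hL _).1
  have hp0 : ∀ i, 0 < p i := fun i => hε.trans_le (hp.2 i)
  have hq0 : ∀ i, 0 < q i := fun i => hε.trans_le (hq.2 i)
  have h1 := le_of_isMinOn_regularized hε η (1 / 16) hp hq (hL hist).2
  have hsplit : leaderValue G H η (1 / 16) L (r.observe tie :: hist) =
      (∑ i, cumulativeEstimate G H L hist i * q i) + regularizer η (1 / 16) q +
        ∑ i, estimator G H p (r.observe tie) i * q i := by
    rw [leaderValue, cumulativeEstimate]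
    simp only [Pi.add_apply, add_mul, sum_add_distrib]
    ring
  rw [hsplit, sum_estimator_observe_mul, leaderValue]
  set x := r.agent.1
  set y : ℝ := ((r.agent.2 : ℤ) : ℝ) with hy
  have hyle : |y| ≤ 1 := by
    rcases Int.units_eq_one_or r.agent.2 with h | h <;> simp [hy, h]
  have hmass : ∀ v : H → ℝ, allNegativeMass G H v x =
      ∑ i ∈ univ.filter (fun i : H => i.1 ∈ allNegative G x), v i := fun v => by
    rw [allNegativeMass, sum_filter]
  by_cases hR : r.hyp ∈ allNegative G x
  · have hne : (univ.filter (fun i : H => i.1 ∈ allNegative G x)).Nonempty :=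
      ⟨⟨r.hyp, hr⟩, by simpa using hR⟩
    have h2 := stability_le_regularizerDivergence hη hp0 hq0 _ hne hyle
    rw [← hmass, ← hmass] at h2
    have hP : 0 < allNegativeMass G H p x := by
      rw [hmass]
      exact sum_pos (fun i _ => hp0 i) hne
    set P := allNegativeMass G H p x
    have e1 : y / P * (P - allNegativeMass G H q x) = y - y / P * allNegativeMass G H q x := by
      field_simp
    have e2 : 9 * η / (4 * P) = 9 * η / 4 / P := by field_simp
    simp only [hR, if_true, one_mul]
    linarith
  · have hD : 0 ≤ regularizerDivergence η (1 / 16) q p := by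
      refine add_nonneg (mul_nonneg (by positivity) (sum_nonneg fun i _ => ?_))
        (mul_nonneg (by norm_num) (sum_nonneg fun i _ => ?_))
      · exact mul_nonneg (hp0 i).le (klFun_nonneg (div_pos (hq0 i) (hp0 i)).le)
      · linarith [Real.log_le_sub_one_of_pos (div_pos (hq0 i) (hp0 i))]
    simp only [hR, if_false, zero_mul]
    linarith

open Classical in
theorem abs_allNegativeMass_mixed_vertex_sub_le {ε : ℝ} (hε : 0 ≤ ε) (k : H) (x : X) :
    |allNegativeMass G H (fun i => (1 - H.card * ε) * (if i = k then 1 else 0) + ε) x -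
      (if k.1 ∈ allNegative G x then 1 else 0)| ≤ H.card * ε := by
  have hmass : allNegativeMass G H (fun i => (1 - H.card * ε) * (if i = k then 1 else 0) + ε) x =
      (1 - H.card * ε) * (if k.1 ∈ allNegative G x then 1 else 0) +
        (univ.filter (fun i : H => i.1 ∈ allNegative G x)).card * ε := by
    rw [allNegativeMass, ← sum_filter, sum_add_distrib, ← mul_sum, sum_ite_eq']
    simp
  have hcard : ((univ.filter (fun i : H => i.1 ∈ allNegative G x)).card : ℝ) ≤ H.card := by
    have := card_filter_le (univ : Finset H) (fun i : H => i.1 ∈ allNegative G x)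
    rw [card_univ, Fintype.card_coe] at this
    exact_mod_cast this
  have h1 := mul_le_mul_of_nonneg_right hcard hε
  have h2 : 0 ≤ ((univ.filter (fun i : H => i.1 ∈ allNegative G x)).card : ℝ) * ε := by positivity
  rw [hmass, abs_le]
  split_ifs <;> constructor <;> linarith

open Classical in
theorem expectation_excessLoss_le {ε η : ℝ} (hε : 0 < ε) (hη : 0 < η) (hε' : H.card * ε ≤ 1)
    (hprop : L.IsProper H) (hL : L.IsFTRL G H ε η (1 / 16)) (k : H) (T : ℕ) :
    expectation (transcriptLaw tie L A T) (excessLoss tie k.1) ≤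
      1 / η * Real.log H.card + 16 * (H.card * Real.log (1 / ε)) +
        T * (9 * η / 4 + H.card * ε) := by
  set u : H → ℝ := fun i => (1 - H.card * ε) * (if i = k then 1 else 0) + ε with hu
  have humem : u ∈ shrunkSimplex H ε := by
    have := mixed_vertex_mem_shrunkSimplex hε.le (by rwa [Fintype.card_coe]) k
    rwa [Fintype.card_coe] at this
  let obs : List (Round X) → List (Observation X) := List.map (Round.observe tie)
  -- The potential whose drift is controlled.
  let Z : List (Round X) → ℝ := fun τ => excessLoss tie k.1 τ -
    leaderValue G H η (1 / 16) L (obs τ) + ∑ i, cumulativeEstimate G H L (obs τ) i * u i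
  have hstep : ∀ τ, ∑ i : H, L.weights H (τ.map (Round.observe tie)) i * Z (⟨i.1, A τ⟩ :: τ) ≤
      Z τ + (9 * η / 4 + H.card * ε) := by
    intro τ
    set p := L.weights H (τ.map (Round.observe tie)) with hpdef
    have hp : p ∈ shrunkSimplex H ε := (hL _).1
    have hp0 : ∀ i, 0 < p i := fun i => hε.trans_le (hp.2 i)
    set x := (A τ).1 with hx
    set y : ℝ := (((A τ).2 : ℤ) : ℝ) with hy
    set P := allNegativeMass G H p x with hPdef
    set U := allNegativeMass G H u x with hUdef
    set I : Classifier X → ℝ := fun h => if h ∈ allNegative G x then 1 else 0 with hI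
    have hU : |U - I k| ≤ H.card * ε := abs_allNegativeMass_mixed_vertex_sub_le hε.le k x
    have hZ : ∀ i : H, Z (⟨i.1, A τ⟩ :: τ) ≤
        Z τ - y * I k + I i * ((9 * η / 4 + y * U) / P) := by
      intro i
      have h1 := leaderValue_observe_cons tie hε hη hL (obs τ) ⟨i.1, A τ⟩ i.2
      have h2 : ∑ j, cumulativeEstimate G H L (obs (⟨i.1, A τ⟩ :: τ)) j * u j =
          (∑ j, cumulativeEstimate G H L (obs τ) j * u j) + I i * (y / P * U) := by
        have h3 := sum_estimator_observe_mul tie p u ⟨i.1, A τ⟩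
        rw [← h3]
        simp only [obs, List.map_cons, cumulativeEstimate, Pi.add_apply, add_mul,
          sum_add_distrib]
        rfl
      have h4 := excessLoss_cons tie k.1 ⟨i.1, A τ⟩ τ
      rw [strategicLoss_eq, strategicLoss_eq] at h4
      have h5 : excessLoss tie k.1 (⟨i.1, A τ⟩ :: τ) = I i * y - I k * y + excessLoss tie k.1 τ := by
        rw [h4]
        simp only [hI, hy, hx]
        ring
      have h6 : leaderValue G H η (1 / 16) L (obs τ) + I i * (y - 9 * η / 4 / P) ≤
        leaderValue G H η (1 / 16) L (obs (⟨i.1, A τ⟩ :: τ)) := h1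
      simp only [Z]
      rw [h2, h5]
      have h7 : I i * ((9 * η / 4 + y * U) / P) =
        I i * (9 * η / 4 / P) + I i * (y / P * U) := by ring
      rw [h7]
      linarith
    have hPsum : ∑ i : H, p i * I i = P := by
      rw [hPdef, allNegativeMass]
      exact sum_congr rfl fun i _ => by simp [hI]
    -- Averaging over the sampled classifier yields a factor `P`, which cancels the importance
    -- weight.
    have hsum : ∑ i : H, p i * Z (⟨i.1, A τ⟩ :: τ) ≤
        Z τ - y * I k + P * ((9 * η / 4 + y * U) / P) := by
      refine (sum_le_sum fun i _ => mul_le_mul_of_nonneg_left (hZ i) (hp0 i).le).trans_eq ?_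
      simp only [mul_add, sum_add_distrib, ← mul_assoc, ← sum_mul, hp.1.2, hPsum, one_mul]
    refine hsum.trans ?_
    have hyle : |y| ≤ 1 := by
      rcases Int.units_eq_one_or (A τ).2 with h | h <;> simp [hy, h]
    have hn : (0 : ℝ) ≤ H.card * ε := by positivity
    have hP0 : 0 ≤ P := by
      rw [← hPsum]
      exact sum_nonneg fun i _ => mul_nonneg (hp0 i).le (by simp only [hI]; split_ifs <;> norm_num)
    -- All weights are positive, so `P = 0` forces `R` to be empty, and then the comparator is not
    -- in `R` either.
    rcases hP0.eq_or_lt with h0 | h0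
    · have hk : I k = 0 := by
        rw [← hPsum] at h0
        have := (sum_eq_zero_iff_of_nonneg fun i _ => mul_nonneg (hp0 i).le
          (by simp only [hI]; split_ifs <;> norm_num)).1 h0.symm k (mem_univ k)
        exact (mul_eq_zero.1 this).resolve_left (hp0 k).ne'
      rw [← h0, hk, mul_zero, zero_mul]
      linarith
    · rw [mul_div_cancel₀ _ h0.ne']
      have : y * (U - I k) ≤ H.card * ε := by
        refine (le_abs_self _).trans ?_
        rw [abs_mul]
        exact (mul_le_of_le_one_left (abs_nonneg _) hyle).trans hU
      linarith
  have hE := expectation_transcriptLaw_le tie A hprop Z _ hstep T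
  -- The leader minimizes the regularized estimate, so its value is at most that of `u`.
  have hcmp : ∀ τ, excessLoss tie k.1 τ ≤ Z τ + regularizer η (1 / 16) u := by
    intro τ
    have h : leaderValue G H η (1 / 16) L (obs τ) ≤ _ := (hL (obs τ)).2 humem
    simp only [Z]
    simp only at h
    linarith
  have hE' := expectation_le_add_const _ (transcriptLaw_support_finite tie A hprop T) hcmp
  have hu' := regularizer_le hε hη.le (by norm_num : (0 : ℝ) ≤ 1 / 16) humem
  have hp' := le_regularizer hε hη.le (by norm_num : (0 : ℝ) ≤ 1 / 16) (hL []).1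
  have hZ0 : Z [] = -regularizer η (1 / 16) (L.weights H []) := by
    simp [Z, excessLoss, leaderValue, obs, cumulativeEstimate]
  rw [Fintype.card_coe] at hu' hp'
  norm_num only [one_div_one_div] at hu' hp' hE' hE hZ0 ⊢
  linarith

theorem expectation_excessLoss_of_subsingleton (hprop : L.IsProper H) (hH : H.card = 1)
    {h : Classifier X} (hh : h ∈ H) (T : ℕ) :
    expectation (transcriptLaw tie L A T) (excessLoss tie h) ≤ 0 := by
  obtain ⟨g, rfl⟩ := card_eq_one.1 hH
  obtain rfl := mem_singleton.1 hh
  have hstep : ∀ τ, ∑ i : ({h} : Finset (Classifier X)),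
      L.weights {h} (τ.map (Round.observe tie)) i * excessLoss tie h (⟨i.1, A τ⟩ :: τ) ≤
        excessLoss tie h τ + 0 := by
    intro τ
    have hi : ∀ i : ({h} : Finset (Classifier X)), i.1 = h := fun i => mem_singleton.1 i.2
    simp only [excessLoss_cons, hi, sub_self, zero_add, add_zero, ← sum_mul]
    have hw : ∑ i, L.weights {h} (τ.map (Round.observe tie)) i = 1 := by
      have := sum_toReal_eq_one (L (τ.map (Round.observe tie))) {h} (hprop _)
      rwa [← sum_coe_sort] at this
    rw [hw, one_mul]
  simpa [excessLoss] using expectation_transcriptLaw_le tie A hprop _ 0 hstep T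

end Regret

end StrategicClassification

end

/-! ### Choice of parameters -/

theorem mainTheorem2 :
    ∃ C : ℝ, 0 < C ∧
      ∀ (X : Type u) (G : Digraph X)
        (H : Finset (StrategicClassification.Classifier X)) (hH : H.Nonempty)
        (T : ℕ), 1 ≤ T →
        ∃ L : StrategicClassification.Learner X,
          L.IsProper H ∧
          L.IsFTRL G H (1 / ((H.card : ℝ) * T)) (Real.sqrt (Real.log H.card / T)) (1 / 16) ∧
          ∀ (tie : StrategicClassification.TieBreaking G)
            (A : StrategicClassification.Adversary X),
            StrategicClassification.expectedRegret tie H hH T L A ≤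
              C * (Real.sqrt (T * Real.log H.card) +
                H.card * Real.log ((H.card : ℝ) * T)) := by
  classical
  refine ⟨17, by norm_num, fun X G H hH T hT => ?_⟩
  have hTpos : (0 : ℝ) < T := by exact_mod_cast hT
  have hT1 : (1 : ℝ) ≤ T := by exact_mod_cast hT
  have hn1 : (1 : ℝ) ≤ H.card := by exact_mod_cast hH.card_pos
  have hn : (0 : ℝ) < H.card := by linarith
  have hε : 0 < 1 / ((H.card : ℝ) * T) := by positivity
  have hnε : H.card * (1 / ((H.card : ℝ) * T)) = 1 / T := by field_simp
  have hε' : H.card * (1 / ((H.card : ℝ) * T)) ≤ 1 := by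
    rw [hnε]
    exact (div_le_one hTpos).2 hT1
  obtain ⟨k, hk⟩ := hH
  obtain ⟨L, hprop, hL⟩ := StrategicClassification.exists_isFTRL G H hε
    ⟨_, StrategicClassification.mixed_vertex_mem_shrunkSimplex hε.le
      (by rwa [Fintype.card_coe]) (⟨k, hk⟩ : H)⟩ (Real.sqrt (Real.log H.card / T)) (1 / 16)
  refine ⟨L, hprop, hL, fun tie A => Finset.sup'_le _ _ fun h hh => ?_⟩
  have hlogT : 0 ≤ Real.log T := Real.log_nonneg hT1
  -- For `n = 1` one has `η = 0`, so the FTRL analysis does not apply (and `1 / η = 0` removes the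
  -- entropy term); but the learner always plays the comparator.
  rcases eq_or_ne H.card 1 with h1 | h1
  · refine (StrategicClassification.expectation_excessLoss_of_subsingleton tie A hprop h1 hh
      T).trans ?_
    rw [h1]
    simp [hlogT]
  · have hn2 : (2 : ℝ) ≤ H.card := by
      have : 2 ≤ H.card := by
        have : 0 < H.card := Finset.card_pos.2 ⟨k, hk⟩
        omega
      exact_mod_cast this
    have hlog2 : Real.log 2 ≤ Real.log H.card := Real.log_le_log (by norm_num) hn2
    have hlogpos : 0 < Real.log H.card := by linarith [Real.log_two_gt_d9]
    have hη : 0 < Real.sqrt (Real.log H.card / T) := Real.sqrt_pos.2 (by positivity)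
    have hmain := StrategicClassification.expectation_excessLoss_le tie A hε hη hε' hprop hL
      ⟨h, hh⟩ T
    refine hmain.trans ?_
    set η := Real.sqrt (Real.log H.card / T)
    have hηsq : η ^ 2 = Real.log H.card / T := Real.sq_sqrt (by positivity)
    have hS : Real.sqrt (T * Real.log H.card) = T * η := by
      rw [Real.sqrt_eq_iff_mul_self_eq (by positivity) (by positivity)]
      have : T * η * (T * η) = T ^ 2 * η ^ 2 := by ring
      rw [this, hηsq]
      field_simp
    -- This `η` balances `log n / η` against `T η`.
    have hent : 1 / η * Real.log H.card = T * η := by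
      have : Real.log H.card = T * η ^ 2 := by rw [hηsq]; field_simp
      rw [this]
      field_simp
    -- Absorbs the total cost `T · nε = 1` of moving the comparator off the vertex; with the
    -- barrier's `16` this gives the constant `17`.
    have hone : 1 ≤ H.card * Real.log ((H.card : ℝ) * T) := by
      rw [Real.log_mul hn.ne' hTpos.ne']
      nlinarith [Real.log_two_gt_d9]
    have hTη : 0 ≤ T * η := by positivity
    have hslack : (T : ℝ) * (9 * η / 4 + 1 / T) = 9 / 4 * (T * η) + 1 := by field_simp
    rw [hnε, hslack, hent, hS, one_div_one_div]
    linarith
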